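/- Let $P$ be a simple polygon in the Euclidean plane with $n\ge 3$ edges, listed counterclockwise, and let $\delta$ assign to every edge $e$ of $P$ a real number $\delta(e)\ge 0$. Write $\overline{e}$ for the supporting line and $n_e$ for the inward unit normal of $e$. A *wavefront propagation* of $(P,\delta)$ is a process of the following kind. At time $0$ the wavefront is $P$. At every time $t$ the wavefront consists of finitely many polygons whose edges (fragments) are each emanated by an edge $e$ of $P$, have the direction of $e$, and lie on $\overline{e}+\max(0,t-\delta(e))\,n_e$; that is, each fragment stands still until time $\delta(e)$ and then moves inwards at unit speed in a self-parallel manner. There are finitely many times $0=t_0<t_1<\dots<t_N$ (event and speed-change times). Between two consecutive times the incidences do not change, the vertices move at constant velocity, and the wavefront is planar: its polygons are simple, have disjoint interiors, and share no pieces of edges, though different polygons may touch in points. A vertex between two fragments of equal direction moves along their common normal. At each time $t_i$ with $i\ge 1$, the wavefront is updated so that it is planar again (edge events, split events, speed changes, and any simultaneous combination of these). Fragments of length zero are removed. If two parallel fragments have moved into each other, the portion common to them is removed. The rest of every fragment stays, and is cut only at points that are reached by wavefront vertices. The ends of the remaining fragments are joined anew to closed polygons, where two pieces of one fragment are not joined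 to each other. The process ends at time $t_N$, when all wavefront polygons have collapsed. The *additively-weighted straight skeleton* $\mathcal S(P,\delta)$ of such a propagation is the union of the traces of all wavefront vertices over the whole propagation period $[0,t_N]$ and of all portions common to two parallel fragments that move into each other. **Lemma.** For every simple polygon $P$, all additive weights $\delta\ge 0$, and every wavefront propagation of $(P,\delta)$, the additively-weighted straight skeleton $\mathcal S(P,\delta)$ is connected; indeed, it is a non-empty path-connected subset of the plane. -/

import Mathlib

open scoped NNReal

noncomputable section

namespace StraightSkeleton

/-- The Euclidean plane. -/
abbrev Plane : Type := EuclideanSpace ℝ (Fin 2)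

/-- Counterclockwise rotation by a right angle. -/
def rot90 (v : Plane) : Plane := !₂[-(v 1), v 0]

/-- The two-dimensional cross product. -/
def cross (u v : Plane) : ℝ := u 0 * v 1 - u 1 * v 0

/-- A finite family of closed polygonal curves is given by a finite set `ι` of vertices, a permutation
`next` of `ι` whose cycles are the curves, and the position of every vertex; its edges are the
segments from `pos v` to `pos (next v)`.  This is the curve that passes through vertex `v`. -/
def curve {ι : Type} (next : Equiv.Perm ι) (pos : ι → Plane) (v : ι) : Set Plane :=
  ⋃ w ∈ {w | next.SameCycle v w}, segment ℝ (pos w) (pos (next w))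

/-- The region enclosed by the curve through `v`: the points off the curve whose connected component in
the complement of the curve is bounded. -/
def enclosed {ι : Type} (next : Equiv.Perm ι) (pos : ι → Plane) (v : ι) : Set Plane :=
  {x | x ∉ curve next pos v ∧
    Bornology.IsBounded (connectedComponentIn (curve next pos v)ᶜ x)}

/-- The family is planar if every curve is a simple polygon, and different polygons neither have
common interior points nor share pieces of edges.  (Different polygons may touch in a
point, as they do at the instant of a split event.) -/
structure Planar {ι : Type} (next : Equiv.Perm ι) (pos : ι → Plane) : Prop where
  /-- The vertices of one polygon are distinct points. -/
  injective : ∀ v w, next.SameCycle v w → pos v = pos w → v = w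
  /-- In one polygon, an open edge meets no other edge. -/
  simple : ∀ v w, next.SameCycle v w → v ≠ w →
    Disjoint (openSegment ℝ (pos v) (pos (next v))) (segment ℝ (pos w) (pos (next w)))
  /-- Open edges of different polygons do not meet. -/
  edges : ∀ v w, ¬ next.SameCycle v w →
    Disjoint (openSegment ℝ (pos v) (pos (next v))) (openSegment ℝ (pos w) (pos (next w)))
  /-- Different polygons have disjoint interiors. -/
  interiors : ∀ v w, ¬ next.SameCycle v w →
    Disjoint (enclosed next pos v) (enclosed next pos w)

/-- Simple polygons with at least three vertices, listed in counterclockwise order (positive signed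
area), so that the interior lies to the left of every edge.  Edge `e` runs from vertex `e` to the
cyclically next vertex `finRotate n e`. -/
structure IsSimpleCCW {n : ℕ} (P : Polygon Plane n) : Prop where
  three_le : 3 ≤ n
  simple : Planar (finRotate n) P.vertices
  ccw : 0 < ∑ i, cross (P i) (P (finRotate n i))

/-- The unit direction vector of edge `e` of `P`. -/
def edgeDir {n : ℕ} (P : Polygon Plane n) (e : Fin n) : Plane :=
  ‖P (finRotate n e) - P e‖⁻¹ • (P (finRotate n e) - P e)

/-- The inward unit normal of edge `e` of a counterclockwise polygon `P`. -/
def inwardNormal {n : ℕ} (P : Polygon Plane n) (e : Fin n) : Plane := rot90 (edgeDir P e)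

/-- The supporting line of edge `e`, translated by `max 0 (t - δ e)` in the direction of the inward
normal: the edge stands still until time `δ e` and then moves inwards at unit speed. -/
def offsetLine {n : ℕ} (P : Polygon Plane n) (δ : Fin n → ℝ≥0) (e : Fin n) (t : ℝ) : Set Plane :=
  (fun x => x + max 0 (t - (δ e : ℝ)) • inwardNormal P e) '' line[ℝ, P e, P (finRotate n e)]

/-- The kinetic wavefront during one period without a combinatorial change.  Its wavefront vertices
are `Fin size`, the cycles of `next` are the wavefront polygons, and the wavefront fragment from `v` to
`next v` is emanated by the polygon edge `label v`.  Every vertex moves at constant velocity from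
`start v` to `finish v`.  `size = 0` is the empty wavefront. -/
structure Stage (n : ℕ) where
  size : ℕ
  next : Equiv.Perm (Fin size)
  label : Fin size → Fin n
  start : Fin size → Plane
  finish : Fin size → Plane

namespace Stage

variable {n : ℕ}

/-- The position at time `t` of vertex `v` of a stage that lasts from time `a` to time `b`. -/
def pos (S : Stage n) (a b t : ℝ) (v : Fin S.size) : Plane :=
  AffineMap.lineMap (S.start v) (S.finish v) ((t - a) / (b - a))

/-- The trace of vertex `v` of a stage that lasts from time `a` to time `b`. -/
def trace (S : Stage n) (a b : ℝ) (v : Fin S.size) : Set Plane :=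
  (fun t => S.pos a b t v) '' Set.Icc a b

/-- The initial position of the wavefront fragment from `v` to `next v`. -/
def startFragment (S : Stage n) (v : Fin S.size) : Set Plane :=
  segment ℝ (S.start v) (S.start (S.next v))

/-- The limit position, at the end of the stage, of the wavefront fragment from `v` to `next v`. -/
def finishFragment (S : Stage n) (v : Fin S.size) : Set Plane :=
  segment ℝ (S.finish v) (S.finish (S.next v))

/-- The portion common to the fragments at `v` and `w` at the end of the stage, if these fragments are
parallel and face each other (so that they have moved into each other). -/
def commonPortion (P : Polygon Plane n) (S : Stage n) (v w : Fin S.size) : Set Plane :=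
  {x | edgeDir P (S.label v) = -edgeDir P (S.label w) ∧
    x ∈ S.finishFragment v ∧ x ∈ S.finishFragment w}

/-- The stage `S` starts with exactly the polygon `P`. -/
def StartsWith (P : Polygon Plane n) (S : Stage n) : Prop :=
  ∃ φ : Fin n ≃ Fin S.size, ∀ i,
    S.next (φ i) = φ (finRotate n i) ∧ S.label (φ i) = i ∧ S.start (φ i) = P i

/-- The motion of the wavefront between the times `a` and `b`. -/
structure IsMotion (P : Polygon Plane n) (δ : Fin n → ℝ≥0) (S : Stage n) (a b : ℝ) : Prop where
  /-- Every fragment lies on the moving line of the polygon edge that emanated it. -/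
  mem_line : ∀ v, ∀ t ∈ Set.Icc a b,
    segment ℝ (S.pos a b t v) (S.pos a b t (S.next v)) ⊆ offsetLine P δ (S.label v) t
  /-- Fragments have positive length and keep the direction of their polygon edge (hence the
  interior of the wavefront stays on their left), until the end of the stage. -/
  direction : ∀ v, ∀ t ∈ Set.Ico a b, ∃ c : ℝ, 0 < c ∧
    S.pos a b t (S.next v) - S.pos a b t v = c • edgeDir P (S.label v)
  /-- The wavefront is planar until the end of the stage. -/
  planar : ∀ t ∈ Set.Ico a b, Planar S.next (S.pos a b t)
  /-- A vertex between two fragments of equal direction, for which the two moving lines do not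
  determine the position, moves along the angular bisector, that is, along the common normal. -/
  tangential : ∀ v, edgeDir P (S.label v) = edgeDir P (S.label (S.next v)) →
    ∃ s : ℝ, S.finish (S.next v) - S.start (S.next v) = s • inwardNormal P (S.label v)

/-- The update of the wavefront at the end of the stage `S`; `T` is the stage that follows.  This
covers edge events, split events, speed-change events, parallel fragments that move into
each other, the collapse of wavefront polygons, and any simultaneous occurrence of these.
Fragments of length zero and common portions of parallel fragments that moved into each other are
removed; the rest of every fragment stays, cut into pieces by the vertices that reached it;
and the ends of the remaining fragments are joined anew to form the polygons of `T`. -/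
def Event (P : Polygon Plane n) (S T : Stage n) : Prop :=
  ∃ origin : Fin T.size → Fin S.size,
    -- every new fragment is a piece of an old one, emanated by the same polygon edge
    (∀ w, T.label w = S.label (origin w) ∧
      T.startFragment w ⊆ S.finishFragment (origin w)) ∧
    -- vertices of the new wavefront are only at loci of vertices of the old one
    (∀ w, ∃ u, T.start w = S.finish u) ∧
    -- consecutive new fragments are not pieces of the same old fragment
    (∀ w, origin (T.next w) ≠ origin w) ∧
    -- common portions are removed from the wavefront
    (∀ w v, v ≠ origin w →
      Disjoint (openSegment ℝ (T.start w) (T.start (T.next w)))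
        (commonPortion P S (origin w) v)) ∧
    -- nothing else is removed from a fragment of positive length
    (∀ v, S.finish v ≠ S.finish (S.next v) →
      S.finishFragment v ⊆
        (⋃ w ∈ {w | origin w = v}, T.startFragment w) ∪
        ⋃ u ∈ {u | u ≠ v}, commonPortion P S v u)

end Stage

/-- A wavefront propagation process of the polygon `P` with additive weights `δ`: it starts at
time `0` with `P`, and ends after finitely many stages, when all wavefront polygons have collapsed.
Stage `k` lasts from `time k` to `time (k + 1)`. -/
structure Propagation {n : ℕ} (P : Polygon Plane n) (δ : Fin n → ℝ≥0) where
  numStages : ℕ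
  time : ℕ → ℝ
  stage : ℕ → Stage n
  time_zero : time 0 = 0
  time_lt : ∀ k < numStages, time k < time (k + 1)
  initial : (stage 0).StartsWith P
  motion : ∀ k < numStages, (stage k).IsMotion P δ (time k) (time (k + 1))
  event : ∀ k < numStages, (stage k).Event P (stage (k + 1))
  collapsed : (stage numStages).size = 0

/-- The additively-weighted straight skeleton, as a subset of the plane: the union of the traces of
all wavefront vertices over the whole propagation period, and of the portions common to two
parallel wavefront fragments that move into each other. -/
def Propagation.skeleton {n : ℕ} {P : Polygon Plane n} {δ : Fin n → ℝ≥0}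
    (W : Propagation P δ) : Set Plane :=
  (⋃ k ∈ Set.Iio W.numStages, ⋃ v : Fin (W.stage k).size,
    (W.stage k).trace (W.time k) (W.time (k + 1)) v) ∪
  ⋃ k ∈ Set.Iio W.numStages, ⋃ v : Fin (W.stage k).size, ⋃ u ∈ {u | u ≠ v},
    (W.stage k).commonPortion P v u

end StraightSkeleton

end

namespace StraightSkeleton

/-! The core claim is that the two ends of every wavefront fragment are joined by a path inside the
skeleton (`joinedIn_start_next`). It is proved backwards in time, from the empty final wavefront.
Within a stage, the traces carry the ends of a fragment to their final positions. At the event, the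
final fragment, if not collapsed to a point, is covered by fragments of the next stage, whose ends
are joined by induction, and by common portions, which belong to the skeleton. Distinct pieces meet
only at fragment ends or in common portions, and a segment is connected, so a path can be routed
from one end to the other through the pieces (`joinedIn_finish`).

Going around the single polygon `P`, this joins all initial vertices. Forwards in time, each new
vertex starts where an old one finished, so every trace is joined to the initial vertices; each
nonempty common portion is convex and contains a final vertex position, so it is joined as well. -/

/-- If a preconnected set is covered by finitely many closed sets, then a property of these sets that
is inherited by sets that meet inside the preconnected set propagates from one set to all. -/
theorem IsPreconnected.propagate_closed_cover {X I : Type*} [TopologicalSpace X] [Finite I]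
    {K : Set X} (hK : IsPreconnected K) {C : I → Set X} (hC : ∀ i, IsClosed (C i))
    (hcover : K ⊆ ⋃ i, C i) {p : I → Prop}
    (hp : ∀ i j, (K ∩ (C i ∩ C j)).Nonempty → p i → p j)
    {i j : I} (hi : (K ∩ C i).Nonempty) (hj : (K ∩ C j).Nonempty) (h : p i) : p j := by
  by_contra hn
  have hA : IsClosed (⋃ i ∈ {i | p i}, C i) := (Set.toFinite _).isClosed_biUnion fun i _ => hC i
  have hB : IsClosed (⋃ i ∈ {i | ¬ p i}, C i) := (Set.toFinite _).isClosed_biUnion fun i _ => hC i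
  obtain ⟨x, hxK, hxA, hxB⟩ := isPreconnected_closed_iff.1 hK _ _ hA hB
    (fun x hx => by
      obtain ⟨l, hl⟩ := Set.mem_iUnion.1 (hcover hx)
      by_cases hpl : p l
      · exact Or.inl (Set.mem_biUnion (show l ∈ {i | p i} from hpl) hl)
      · exact Or.inr (Set.mem_biUnion (show l ∈ {i | ¬ p i} from hpl) hl))
    (hi.mono fun x hx => ⟨hx.1, Set.mem_biUnion (show i ∈ {i | p i} from h) hx.2⟩)
    (hj.mono fun x hx => ⟨hx.1, Set.mem_biUnion (show j ∈ {i | ¬ p i} from hn) hx.2⟩)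
  simp only [Set.mem_iUnion, Set.mem_ofPred_eq, exists_prop] at hxA hxB
  obtain ⟨l, hl, hxl⟩ := hxA
  obtain ⟨m, hm, hxm⟩ := hxB
  exact hm (hp l m ⟨x, hxK, hxl, hxm⟩ hl)

/-! ### Parallel segments and subsegments. -/

section Segments

variable {E : Type*} [AddCommGroup E] [Module ℝ E]

theorem eq_or_eq_or_mem_openSegment {a b x : E} (hx : x ∈ segment ℝ a b) :
    x = a ∨ x = b ∨ x ∈ openSegment ℝ a b := by
  rw [← insert_endpoints_openSegment] at hx
  exact hx

/-- An endpoint of a segment is an endpoint of every subsegment that contains it. -/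
theorem endpoint_of_mem_subsegment {a b c d : E} (h : segment ℝ c d ⊆ segment ℝ a b)
    (ha : a ∈ segment ℝ c d) : a = c ∨ a = d := by
  have hc := h (left_mem_segment ℝ c d)
  have hd := h (right_mem_segment ℝ c d)
  rw [segment_eq_image'] at hc hd ha
  obtain ⟨s, ⟨hs0, -⟩, rfl⟩ := hc
  obtain ⟨t, ⟨ht0, -⟩, rfl⟩ := hd
  obtain ⟨r, ⟨hr0, hr1⟩, hr⟩ := ha
  simp only at hr ⊢
  -- In the parametrisation from `a`, the point `a` has parameter 0, here a convex combination of
  -- `s, t ≥ 0`; both terms must vanish unless `a = b`.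
  have h0 : ((1 - r) * s + r * t) • (b - a) = 0 := by
    have : ((1 - r) * s + r * t) • (b - a)
        = (a + s • (b - a) + r • (a + t • (b - a) - (a + s • (b - a)))) - a := by module
    rw [this, hr, sub_self]
  rcases smul_eq_zero.1 h0 with h0 | h0
  · have h1 : 0 ≤ (1 - r) * s := mul_nonneg (by linarith) hs0
    have h2 : 0 ≤ r * t := mul_nonneg hr0 ht0
    have h3 : (1 - r) * s = 0 := by linarith
    have h4 : r * t = 0 := by linarith
    rcases mul_eq_zero.1 h3 with h | h
    · rcases mul_eq_zero.1 h4 with h' | h'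
      · linarith
      · right; simp [h']
    · left; simp [h]
  · left; simp [h0]

theorem add_smul_mem_segment {x d : E} {α β γ : ℝ} (h₁ : α ≤ γ) (h₂ : γ ≤ β) :
    x + γ • d ∈ segment ℝ (x + α • d) (x + β • d) := by
  have h : γ ∈ segment ℝ α β := by rw [segment_eq_Icc (h₁.trans h₂)]; exact ⟨h₁, h₂⟩
  obtain ⟨r, s, hr, hs, hrs, rfl⟩ := h
  refine ⟨r, s, hr, hs, hrs, ?_⟩
  simp only [smul_eq_mul]
  have : r = 1 - s := by linarith
  subst this
  module

/-- A point of a segment in direction `d` splits it into an initial and a final part. -/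
theorem exists_smul_of_mem_segment {a b x d : E} {c : ℝ} (h : b - a = c • d)
    (hx : x ∈ segment ℝ a b) :
    ∃ α β : ℝ, α ≤ 0 ∧ 0 ≤ β ∧
      ((a = x + α • d ∧ b = x + β • d) ∨ (a = x + β • d ∧ b = x + α • d)) := by
  rw [segment_eq_image'] at hx
  obtain ⟨r, ⟨hr0, hr1⟩, rfl⟩ := hx
  have hb : b = a + c • d := by rw [← h]; abel
  subst hb
  have h1 : 0 ≤ 1 - r := by linarith
  rcases le_total 0 c with hc | hc
  · refine ⟨-(r * c), (1 - r) * c, by nlinarith, mul_nonneg h1 hc, Or.inl ⟨?_, ?_⟩⟩ <;>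
    · simp only [add_sub_cancel_left]; module
  · refine ⟨(1 - r) * c, -(r * c), by nlinarith, by nlinarith, Or.inr ⟨?_, ?_⟩⟩ <;>
    · simp only [add_sub_cancel_left]; module

/-- If two parallel segments meet, an endpoint of one of them lies in both. -/
theorem exists_endpoint_mem_inter {a b a' b' x d : E} {c c' : ℝ} (h : b - a = c • d)
    (h' : b' - a' = c' • d) (hx : x ∈ segment ℝ a b) (hx' : x ∈ segment ℝ a' b') :
    ∃ y, (y = a ∨ y = b ∨ y = a' ∨ y = b') ∧ y ∈ segment ℝ a b ∧ y ∈ segment ℝ a' b' := by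
  obtain ⟨α, β, hα, hβ, H⟩ := exists_smul_of_mem_segment h hx
  obtain ⟨α', β', hα', hβ', H'⟩ := exists_smul_of_mem_segment h' hx'
  have hab : segment ℝ a b = segment ℝ (x + α • d) (x + β • d) := by
    rcases H with ⟨rfl, rfl⟩ | ⟨rfl, rfl⟩
    · rfl
    · exact segment_symm _ _ _
  have hab' : segment ℝ a' b' = segment ℝ (x + α' • d) (x + β' • d) := by
    rcases H' with ⟨rfl, rfl⟩ | ⟨rfl, rfl⟩
    · rfl
    · exact segment_symm _ _ _
  rw [hab, hab']
  -- With the common point `x` as origin both parameter intervals contain 0, so the smaller of the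
  -- two upper ends lies in both.
  rcases le_total β β' with hle | hle
  · refine ⟨x + β • d, ?_, right_mem_segment _ _ _, add_smul_mem_segment (by linarith) hle⟩
    rcases H with ⟨-, e⟩ | ⟨e, -⟩ <;> simp [e]
  · refine ⟨x + β' • d, ?_, add_smul_mem_segment (by linarith) hle, right_mem_segment _ _ _⟩
    rcases H' with ⟨-, e⟩ | ⟨e, -⟩ <;> simp [e]

/-- If an endpoint of a segment lies in an open segment of the same direction, then the open
segments meet. -/
theorem not_disjoint_openSegment_of_endpoint_mem {a b a' b' d : E} {c c' : ℝ} (hc : 0 < c)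
    (hc' : 0 < c') (h : b - a = c • d) (h' : b' - a' = c' • d)
    (hx : a' ∈ openSegment ℝ a b ∨ b' ∈ openSegment ℝ a b) :
    ¬ Disjoint (openSegment ℝ a b) (openSegment ℝ a' b') := by
  have hb : b = a + c • d := by rw [← h]; abel
  have hb' : b' = a' + c' • d := by rw [← h']; abel
  subst hb hb'
  rw [Set.not_disjoint_iff]
  simp only [openSegment_eq_image', add_sub_cancel_left] at hx ⊢
  rcases hx with ⟨r, ⟨hr0, hr1⟩, e⟩ | ⟨r, ⟨hr0, hr1⟩, e⟩
  · simp only at e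
    -- Move forwards from `a'` by less than both the remaining part of the first segment and the
    -- second segment; the other case moves backwards from `b'`.
    obtain ⟨ε, hε, h1⟩ := exists_between (lt_min (mul_pos (sub_pos.2 hr1) hc) hc')
    obtain ⟨h1, h2⟩ := lt_min_iff.1 h1
    refine ⟨a' + ε • d, ⟨r + ε / c, ⟨by positivity, ?_⟩, ?_⟩, ⟨ε / c', ⟨by positivity, ?_⟩, ?_⟩⟩
    · have := (div_lt_iff₀ hc).2 h1
      linarith
    · rw [← e]
      simp only [smul_smul, add_mul, div_mul_cancel₀ _ hc.ne']
      module
    · exact (div_lt_one hc').2 h2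
    · simp only [smul_smul, div_mul_cancel₀ _ hc'.ne']
  · simp only at e
    obtain ⟨ε, hε, h1⟩ := exists_between (lt_min (mul_pos hr0 hc) hc')
    obtain ⟨h1, h2⟩ := lt_min_iff.1 h1
    have h3 := (div_lt_iff₀ hc).2 h1
    have h4 := (div_lt_one hc').2 h2
    have : 0 < ε / c := by positivity
    have : 0 < ε / c' := by positivity
    refine ⟨a' + c' • d - ε • d, ⟨r - ε / c, ⟨by linarith, by linarith⟩, ?_⟩,
      ⟨1 - ε / c', ⟨by linarith, by linarith⟩, ?_⟩⟩
    · rw [← e]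
      simp only [smul_smul, sub_mul, div_mul_cancel₀ _ hc.ne']
      module
    · simp only [smul_smul, sub_mul, div_mul_cancel₀ _ hc'.ne']
      module

end Segments

theorem isClosed_segment (a b : Plane) : IsClosed (segment ℝ a b) := by
  rw [← convexHull_pair]
  exact (Set.toFinite _).isClosed_convexHull ℝ

namespace Planar

theorem disjoint_openSegment {ι : Type} {next : Equiv.Perm ι} {pos : ι → Plane}
    (h : Planar next pos) {v w : ι} (hvw : v ≠ w) :
    Disjoint (openSegment ℝ (pos v) (pos (next v))) (openSegment ℝ (pos w) (pos (next w))) := by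
  by_cases hs : next.SameCycle v w
  · exact (h.simple v w hs hvw).mono_right (openSegment_subset_segment ℝ _ _)
  · exact h.edges v w hs

end Planar

/-! ### A single stage and the event at its end. -/

namespace Stage

variable {n : ℕ} {P : Polygon Plane n} {δ : Fin n → ℝ≥0} {S T : Stage n} {a b : ℝ}

theorem pos_left (S : Stage n) (a b : ℝ) : S.pos a b a = S.start := by
  ext1 v; simp [pos]

theorem pos_right (S : Stage n) (h : a < b) : S.pos a b b = S.finish := by
  ext1 v; simp [pos, div_self (sub_pos.2 h).ne']

theorem start_mem_trace (S : Stage n) (h : a < b) (v : Fin S.size) : S.start v ∈ S.trace a b v :=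
  ⟨a, Set.left_mem_Icc.2 h.le, by simp only [pos_left]⟩

theorem finish_mem_trace (S : Stage n) (h : a < b) (v : Fin S.size) :
    S.finish v ∈ S.trace a b v :=
  ⟨b, Set.right_mem_Icc.2 h.le, by simp only [pos_right S h]⟩

theorem isPathConnected_trace (S : Stage n) (h : a < b) (v : Fin S.size) :
    IsPathConnected (S.trace a b v) := by
  refine ((convex_Icc a b).isPathConnected ⟨a, Set.left_mem_Icc.2 h.le⟩).image ?_
  simp only [pos, AffineMap.lineMap_apply]
  fun_prop

theorem convex_commonPortion (v w : Fin S.size) : Convex ℝ (S.commonPortion P v w) := by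
  intro x hx y hy r s hr hs hrs
  exact ⟨hx.1, convex_segment _ _ hx.2.1 hy.2.1 hr hs hrs, convex_segment _ _ hx.2.2 hy.2.2 hr hs hrs⟩

theorem isClosed_commonPortion (v w : Fin S.size) : IsClosed (S.commonPortion P v w) := by
  by_cases h : edgeDir P (S.label v) = -edgeDir P (S.label w)
  · have : S.commonPortion P v w = S.finishFragment v ∩ S.finishFragment w := by
      ext x; simp [commonPortion, h]
    rw [this]
    exact (isClosed_segment _ _).inter (isClosed_segment _ _)
  · have : S.commonPortion P v w = ∅ := by
      ext x; simp [commonPortion, h]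
    rw [this]
    exact isClosed_empty

/-- At the end of a stage, every fragment has the direction of its polygon edge. -/
theorem IsMotion.finish_direction (hS : S.IsMotion P δ a b) (h : a < b) (v : Fin S.size) :
    ∃ c : ℝ, S.finish (S.next v) - S.finish v = c • edgeDir P (S.label v) := by
  -- The field `direction` excludes time `b`, so the direction is read off from the supporting line,
  -- without control of the sign of `c`.
  have hl := hS.mem_line v b (Set.right_mem_Icc.2 h.le)
  rw [pos_right S h] at hl
  obtain ⟨x, hx, hx'⟩ := hl (left_mem_segment ℝ _ _)
  obtain ⟨y, hy, hy'⟩ := hl (right_mem_segment ℝ _ _)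
  have hd : y -ᵥ x ∈ (line[ℝ, P (S.label v), P (finRotate n (S.label v))]).direction :=
    AffineSubspace.vsub_mem_direction hy hx
  rw [direction_affineSpan, mem_vectorSpan_pair_rev] at hd
  obtain ⟨r, hr⟩ := hd
  simp only [vsub_eq_sub] at hr
  rw [← hx', ← hy', add_sub_add_right_eq_sub, ← hr]
  set D := P (finRotate n (S.label v)) - P (S.label v) with hD
  by_cases h0 : D = 0
  · exact ⟨0, by simp [h0]⟩
  · refine ⟨r * ‖D‖, ?_⟩
    rw [edgeDir, ← hD, smul_smul, mul_assoc, mul_inv_cancel₀ (norm_ne_zero_iff.2 h0), mul_one]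

/-- A non-empty common portion contains the final position of a wavefront vertex. -/
theorem IsMotion.exists_finish_mem_commonPortion (hS : S.IsMotion P δ a b) (h : a < b)
    {v w : Fin S.size} {x : Plane} (hx : x ∈ S.commonPortion P v w) :
    ∃ u, S.finish u ∈ S.commonPortion P v w := by
  obtain ⟨c, hc⟩ := hS.finish_direction h v
  obtain ⟨c', hc'⟩ := hS.finish_direction h w
  rw [hx.1, smul_neg, ← neg_smul] at hc
  obtain ⟨y, hy, hyv, hyw⟩ := exists_endpoint_mem_inter hc hc' hx.2.1 hx.2.2
  have hm : y ∈ S.commonPortion P v w := ⟨hx.1, hyv, hyw⟩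
  rcases hy with rfl | rfl | rfl | rfl <;> exact ⟨_, hm⟩

/-- If in the next stage the ends of every fragment are joined inside a set that contains all final
vertex positions and all common portions, then so are the ends of every final fragment. -/
theorem Event.joinedIn_finish {F : Set Plane} (hE : S.Event P T)
    (hdir : ∀ w, ∃ c : ℝ, 0 < c ∧ T.start (T.next w) - T.start w = c • edgeDir P (T.label w))
    (hdisj : ∀ w w', w ≠ w' → Disjoint (openSegment ℝ (T.start w) (T.start (T.next w)))
      (openSegment ℝ (T.start w') (T.start (T.next w'))))
    (hfin : ∀ v, S.finish v ∈ F) (hcp : ∀ v u, u ≠ v → S.commonPortion P v u ⊆ F)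
    (hT : ∀ w, JoinedIn F (T.start w) (T.start (T.next w))) (v : Fin S.size) :
    JoinedIn F (S.finish v) (S.finish (S.next v)) := by
  by_cases hv : S.finish v = S.finish (S.next v)
  · rw [← hv]; exact JoinedIn.refl (hfin v)
  obtain ⟨origin, hpiece, -, -, hrem, hcov⟩ := hE
  replace hcov := hcov v hv
  -- Only nonempty common portions are kept, so that each is path-connected.
  let I := {w : Fin T.size // origin w = v} ⊕
    {u : Fin S.size // u ≠ v ∧ (S.commonPortion P v u).Nonempty}
  let C : I → Set Plane := Sum.elim (fun w => T.startFragment w) fun u => S.commonPortion P v u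
  -- the points of the closed pieces that are known to lie in `F`
  let R : I → Set Plane := Sum.elim (fun w => {T.start w, T.start (T.next w)})
    fun u => S.commonPortion P v u
  have hR : ∀ i, ∀ x ∈ R i, ∀ y ∈ R i, JoinedIn F x y := by
    rintro (⟨w, hw⟩ | ⟨u, hu, hne⟩) x hx y hy
    · have := hT w
      rcases hx with rfl | rfl <;> rcases hy with rfl | rfl
      · exact JoinedIn.refl this.source_mem
      · exact this
      · exact this.symm
      · exact JoinedIn.refl this.target_mem
    · exact (((convex_commonPortion v u).isPathConnected hne).joinedIn x hx y hy).mono (hcp v u hu)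
  have hRC : ∀ i j, i ≠ j → ∀ x ∈ C i, x ∈ C j → x ∈ R i := by
    rintro (⟨w, hw⟩ | ⟨u, hu, hne⟩) j hij x hxi hxj
    · rcases eq_or_eq_or_mem_openSegment hxi with h | h | h
      · exact Or.inl h
      · exact Or.inr h
      exfalso
      rcases j with ⟨w', hw'⟩ | ⟨u, hu, hne⟩
      · have hww : w ≠ w' := fun h => hij (by subst h; rfl)
        obtain ⟨c, hc, hd⟩ := hdir w
        obtain ⟨c', hc', hd'⟩ := hdir w'
        -- Pieces of one fragment have the same direction, so an end of one inside the other would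
        -- make their open segments overlap.
        have hl : T.label w' = T.label w := by
          rw [(hpiece w).1, (hpiece w').1, hw, hw']
        rw [hl] at hd'
        rcases eq_or_eq_or_mem_openSegment hxj with h' | h' | h'
        · exact not_disjoint_openSegment_of_endpoint_mem hc hc' hd hd' (Or.inl (h' ▸ h))
            (hdisj w w' hww)
        · exact not_disjoint_openSegment_of_endpoint_mem hc hc' hd hd'
            (Or.inr (h' ▸ h)) (hdisj w w' hww)
        · exact Set.disjoint_left.1 (hdisj w w' hww) h h'
      · refine Set.disjoint_left.1 (hrem w u (hw.symm ▸ hu)) h ?_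
        rw [hw]; exact hxj
    · exact hxi
  have hcover : S.finishFragment v ⊆ ⋃ i, C i := by
    intro x hx
    rcases hcov hx with h | h
    · obtain ⟨w, hw, hxw⟩ := Set.mem_iUnion₂.1 h
      exact Set.mem_iUnion.2 ⟨Sum.inl ⟨w, hw⟩, hxw⟩
    · obtain ⟨u, hu, hxu⟩ := Set.mem_iUnion₂.1 h
      exact Set.mem_iUnion.2 ⟨Sum.inr ⟨u, hu, x, hxu⟩, hxu⟩
  -- Stated for arbitrary `y z` to serve both ends of the fragment.
  have hend : ∀ y z, S.finishFragment v = segment ℝ y z → ∀ i, y ∈ C i → y ∈ R i := by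
    rintro y z he (⟨w, hw⟩ | ⟨u, hu, hne⟩) hy
    · have hsub := (hpiece w).2
      rw [hw, he] at hsub
      exact endpoint_of_mem_subsegment hsub hy
    · exact hy
  have hleft : S.finish v ∈ S.finishFragment v := left_mem_segment ℝ _ _
  have hright : S.finish (S.next v) ∈ S.finishFragment v := right_mem_segment ℝ _ _
  obtain ⟨i, hi⟩ := Set.mem_iUnion.1 (hcover hleft)
  obtain ⟨j, hj⟩ := Set.mem_iUnion.1 (hcover hright)
  refine IsPreconnected.propagate_closed_cover (C := C)
    (p := fun i => ∀ x ∈ R i, JoinedIn F (S.finish v) x)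
    (convex_segment (S.finish v) (S.finish (S.next v))).isPreconnected ?_ hcover ?_
    ⟨_, hleft, hi⟩ ⟨_, hright, hj⟩ ?_ _ (hend _ _ (segment_symm ℝ _ _) j hj)
  · rintro (w | u)
    · exact isClosed_segment _ _
    · exact isClosed_commonPortion _ _
  · rintro k l ⟨x, -, hxk, hxl⟩ hk y hy
    by_cases hkl : k = l
    · subst hkl; exact hk y hy
    · exact (hk x (hRC k l hkl x hxk hxl)).trans (hR l x (hRC l k (Ne.symm hkl) x hxl hxk) y hy)
  · exact hR i _ (hend _ _ rfl i hi)

end Stage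

/-! ### Induction over the stages. -/

namespace Propagation

variable {n : ℕ} {P : Polygon Plane n} {δ : Fin n → ℝ≥0} (W : Propagation P δ)

theorem trace_subset_skeleton {k : ℕ} (hk : k < W.numStages) (v : Fin (W.stage k).size) :
    (W.stage k).trace (W.time k) (W.time (k + 1)) v ⊆ W.skeleton := fun _ hx =>
  Or.inl (Set.mem_biUnion (show k ∈ Set.Iio W.numStages from hk) (Set.mem_iUnion.2 ⟨v, hx⟩))

theorem commonPortion_subset_skeleton {k : ℕ} (hk : k < W.numStages)
    (v u : Fin (W.stage k).size) (hu : u ≠ v) :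
    (W.stage k).commonPortion P v u ⊆ W.skeleton := fun _ hx =>
  Or.inr (Set.mem_biUnion (show k ∈ Set.Iio W.numStages from hk)
    (Set.mem_iUnion.2 ⟨v, Set.mem_biUnion (show u ∈ {u | u ≠ v} from hu) hx⟩))

theorem joinedIn_of_mem_trace {k : ℕ} (hk : k < W.numStages) {v : Fin (W.stage k).size}
    {x y : Plane} (hx : x ∈ (W.stage k).trace (W.time k) (W.time (k + 1)) v)
    (hy : y ∈ (W.stage k).trace (W.time k) (W.time (k + 1)) v) : JoinedIn W.skeleton x y :=
  (((W.stage k).isPathConnected_trace (W.time_lt k hk) v).joinedIn x hx y hy).mono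
    (W.trace_subset_skeleton hk v)

/-- Adjacent vertices of a wavefront polygon are joined inside the skeleton. -/
theorem joinedIn_start_next {k : ℕ} (hk : k ≤ W.numStages) (v : Fin (W.stage k).size) :
    JoinedIn W.skeleton ((W.stage k).start v) ((W.stage k).start ((W.stage k).next v)) := by
  induction hk using Nat.decreasingInduction with
  | self => exact (finCongr W.collapsed v).elim0
  | of_succ k hk ih =>
    have hlt := W.time_lt k hk
    have htr : ∀ v, JoinedIn W.skeleton ((W.stage k).start v) ((W.stage k).finish v) := fun v =>
      W.joinedIn_of_mem_trace hk ((W.stage k).start_mem_trace hlt v)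
        ((W.stage k).finish_mem_trace hlt v)
    -- Motion data exist only before `numStages`; a stage that has a vertex cannot be the empty last
    -- one.
    have hnext : ∀ w : Fin (W.stage (k + 1)).size, k + 1 < W.numStages := fun w => by
      refine lt_of_le_of_ne hk fun h => ?_
      have h0 := W.collapsed
      rw [← h] at h0
      exact (finCongr h0 w).elim0
    refine ((htr v).trans ?_).trans (htr _).symm
    refine (W.event k hk).joinedIn_finish (fun w => ?_) (fun w w' hww => ?_)
      (fun v => (htr v).target_mem) (W.commonPortion_subset_skeleton hk) ih v
    · have := (W.motion _ (hnext w)).direction w _ (Set.left_mem_Ico.2 (W.time_lt _ (hnext w)))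
      rwa [Stage.pos_left] at this
    · have := (W.motion _ (hnext w)).planar _ (Set.left_mem_Ico.2 (W.time_lt _ (hnext w)))
      rw [Stage.pos_left] at this
      exact this.disjoint_openSegment hww

/-- All initial wavefront vertices are joined inside the skeleton. -/
theorem joinedIn_start_initial (v w : Fin (W.stage 0).size) :
    JoinedIn W.skeleton ((W.stage 0).start v) ((W.stage 0).start w) := by
  obtain ⟨φ, hφ⟩ := W.initial
  have hstep := W.joinedIn_start_next (Nat.zero_le _)
  obtain ⟨i, rfl⟩ := φ.surjective v
  obtain ⟨j, rfl⟩ := φ.surjective w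
  obtain ⟨m, rfl⟩ : ∃ m, n = m + 1 := ⟨n - 1, by have := i.2; omega⟩
  -- Walking from vertex 0 upwards reaches every vertex, so the closing edge of the polygon is not
  -- needed.
  have h0 : ∀ i : Fin (m + 1),
      JoinedIn W.skeleton ((W.stage 0).start (φ 0)) ((W.stage 0).start (φ i)) := by
    intro i
    induction i using Fin.induction with
    | zero => exact JoinedIn.refl (hstep _).source_mem
    | succ i ih =>
      have h := hstep (φ i.castSucc)
      rw [(hφ _).1, finRotate_apply, Fin.coeSucc_eq_succ] at h
      exact ih.trans h
  exact (h0 i).symm.trans (h0 j)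

/-- Every wavefront vertex is joined to the initial ones inside the skeleton. -/
theorem joinedIn_start (v : Fin (W.stage 0).size) {k : ℕ} (hk : k < W.numStages)
    (w : Fin (W.stage k).size) :
    JoinedIn W.skeleton ((W.stage 0).start v) ((W.stage k).start w) := by
  induction k with
  | zero => exact W.joinedIn_start_initial v w
  | succ k ih =>
    have hk' : k < W.numStages := by omega
    obtain ⟨-, -, hvert, -⟩ := W.event k hk'
    obtain ⟨u, hu⟩ := hvert w
    rw [hu]
    exact (ih hk' u).trans (W.joinedIn_of_mem_trace hk'
      ((W.stage k).start_mem_trace (W.time_lt k hk') u)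
      ((W.stage k).finish_mem_trace (W.time_lt k hk') u))

theorem isPathConnected_skeleton (v : Fin (W.stage 0).size) : IsPathConnected W.skeleton := by
  have htrace : ∀ k, k < W.numStages → ∀ u, ∀ x ∈ (W.stage k).trace (W.time k) (W.time (k + 1)) u,
      JoinedIn W.skeleton ((W.stage 0).start v) x := fun k hk u x hx =>
    (W.joinedIn_start v hk u).trans
      (W.joinedIn_of_mem_trace hk ((W.stage k).start_mem_trace (W.time_lt k hk) u) hx)
  refine ⟨_, (W.joinedIn_start_initial v v).source_mem, fun {x} hx => ?_⟩
  rcases hx with hx | hx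
  · simp only [Set.mem_iUnion] at hx
    obtain ⟨k, hk, u, hx⟩ := hx
    exact htrace k hk u x hx
  · simp only [Set.mem_iUnion] at hx
    obtain ⟨k, hk, w, u, hu, hx⟩ := hx
    obtain ⟨z, hz⟩ := (W.motion k hk).exists_finish_mem_commonPortion (W.time_lt k hk) hx
    exact (htrace k hk z _ ((W.stage k).finish_mem_trace (W.time_lt k hk) z)).trans
      (((((W.stage k).convex_commonPortion w u).isPathConnected ⟨x, hx⟩).joinedIn _ hz _ hx).mono
        (W.commonPortion_subset_skeleton hk w u hu))

end Propagation

end StraightSkeleton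

theorem mainTheorem3 {n : ℕ} (P : Polygon StraightSkeleton.Plane n)
    (hP : StraightSkeleton.IsSimpleCCW P) (δ : Fin n → ℝ≥0)
    (W : StraightSkeleton.Propagation P δ) :
    IsPathConnected W.skeleton := by
  obtain ⟨φ, -⟩ := W.initial
  exact W.isPathConnected_skeleton (φ ⟨0, by have := hP.three_le; omega⟩)
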